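/- Let $m\ge 2$ and let $\Delta_j=[a_j,b_j]$, $a_j<b_j$, $j=1,\dots,m$, be bounded intervals of the real line with $\Delta_j\cap\Delta_{j+1}=\varnothing$ for $j=1,\dots,m-1$; put $\Delta_0=\Delta_{m+1}=\varnothing$. Let $d\eta_j(x)=dx/\sqrt{(b_j-x)(x-a_j)}$ on $\Delta_j$. Let $\mathcal C^+(\vec\Delta)$ be the set of vectors $\vec f=(f_1,\dots,f_m)$ such that $f_j$ is a positive continuous function on $\Delta_{j-1}\cup\Delta_{j+1}$, with the distance $$d(\vec f,\vec g)=\max_{1\le j\le m}\ \sup_{\Delta_{j-1}\cup\Delta_{j+1}}|\ln(f_j/g_j)| .$$ For a function $h\ge0$ on $\Delta_j$ with $\ln h\in L_1(\eta_j)$ (so $h>0$ a.e.), the Szegő function of the (not necessarily finite) measure $h\,d\eta_j$ is $$G(z)=\exp\left[\frac{\sqrt{(z-b_j)(z-a_j)}}{2\pi}\int_{\Delta_j}\frac{\ln h(x)}{x-z}\,d\eta_j(x)\right],\qquad z\in\mathbb C\setminus\Delta_j,$$ where the square root outside the integral is positive for $z>b_j$. The functions of this form are called the Szegő functions on the complement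 of $\Delta_j$. Let $\vec w=(w_1,\dots,w_m)$ be a vector of non-negative functions with $\ln w_j\in L_1(\eta_j)$, $j=1,\dots,m$. Then $(\mathcal C^+(\vec\Delta),d)$ is a complete metric space, and for every $\vec f\in\mathcal C^+(\vec\Delta)$ and every $j$ there is a unique Szegő function $T_j\vec f$ on the complement of $\Delta_j$ such that, with $f_0\equiv f_{m+1}\equiv1$, $$\lim_{y\to0}|T_j\vec f(x+iy)|^2=\frac{f_{j-1}(x)f_{j+1}(x)}{w_j(x)}\qquad\text{for a.e. }x\in\Delta_j .$$ Restricting each $T_j\vec f$ to $\Delta_{j-1}\cup\Delta_{j+1}$ gives a map $\vec T_{\vec w}=(T_1,\dots,T_m):\mathcal C^+(\vec\Delta)\to\mathcal C^+(\vec\Delta)$. Let $\overline m=\lceil m/2\rceil$, and let $$\gamma_m=\begin{cases}(2^{\overline m}-1)/2^{\overline m},& m\text{ even},\\ (2^{\overline m}-2)/2^{\overline m},& m\text{ odd}.\end{cases}$$ Then $\gamma_m<1$ and the $\overline m$-th iterate of $\vec T_{\vec w}$ is a contraction: $$d(\vec T_{\vec w}^{\overline m}\vec f,\vec T_{\vec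 w}^{\overline m}\vec g)\le\gamma_m\,d(\vec f,\vec g)\qquad\text{for all }\vec f,\vec g\in\mathcal C^+(\vec\Delta).$$ Moreover $\vec T_{\vec w}$ has a unique fixed point in $\mathcal C^+(\vec\Delta)$. -/

import Mathlib

open MeasureTheory Filter Topology Set

namespace Szego

noncomputable section

/-! ### Szegő functions on an interval -/

/-- The arcsine measure `dη(x) = dx / √((b - x)(x - a))` on `[a, b]`. -/
def eta (a b : ℝ) : Measure ℝ :=
  (volume.restrict (Icc a b)).withDensity
    fun x => ENNReal.ofReal (1 / Real.sqrt ((b - x) * (x - a)))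

/-- `ln h ∈ L₁(η)` for a non-negative `h`, where `ln 0 = -∞`: the integrability contains that
`h > 0` almost everywhere, which has to be said separately because `Real.log 0 = 0`. -/
def LogIntegrable (a b : ℝ) (h : ℝ → ℝ) : Prop :=
  (∀ᵐ x ∂(eta a b), 0 < h x) ∧ Integrable (fun x => Real.log (h x)) (eta a b)

/-- The branch of `√((z - b)(z - a))` on `ℂ \ [a, b]` that is positive for real `z > b`.
The quotient `(z - b) / (z - a)` avoids the cut `(-∞, 0]` exactly when `z ∉ [a, b]`. -/
def branchSqrt (a b : ℝ) (z : ℂ) : ℂ :=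
  (z - a) * ((z - b) / (z - a)) ^ (1 / 2 : ℂ)

/-- The Szegő function of the measure `h dη` on `[a, b]`, that is, of the measure `μ` with
`√((b - x)(x - a)) μ'(x) = h(x)`:
`G(z) = exp ( √((z - b)(z - a)) / (2π) * ∫ ln h(x) / (x - z) dη(x) )` for `z ∉ [a, b]`. -/
def szegoFun (a b : ℝ) (h : ℝ → ℝ) (z : ℂ) : ℂ :=
  Complex.exp (branchSqrt a b z / (2 * (Real.pi : ℂ)) *
    ∫ x, ((Real.log (h x) : ℝ) : ℂ) / ((x : ℂ) - z) ∂(eta a b))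

/-- `G` is, off `[a, b]`, the Szegő function of some measure `h dη` with `ln h ∈ L₁(η)`. -/
def IsSzegoFun (a b : ℝ) (G : ℂ → ℂ) : Prop :=
  ∃ h : ℝ → ℝ, LogIntegrable a b h ∧ ∀ z : ℂ, z ∉ ((↑) : ℝ → ℂ) '' Icc a b → G z = szegoFun a b h z

/-! ### The space of positive continuous vector functions -/

variable {m : ℕ}

/-- `i` and `j` are neighbouring indices, `i = j ± 1`. -/
abbrev Adj (i j : Fin m) : Prop := (i : ℕ) + 1 = j ∨ (j : ℕ) + 1 = i

/-- `Δ_{j-1} ∪ Δ_{j+1}`, where `Δ_i = [a i, b i]` and an interval whose index is out of range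
is empty. -/
def nbrSet (a b : Fin m → ℝ) (j : Fin m) : Set ℝ :=
  ⋃ i : {i : Fin m // Adj i j}, Icc (a i) (b i)

theorem mem_nbrSet {a b : Fin m → ℝ} {i j : Fin m} (h : Adj i j) {x : ℝ}
    (hx : x ∈ Icc (a j) (b j)) : x ∈ nbrSet a b i :=
  mem_iUnion.2 ⟨⟨j, h.symm⟩, hx⟩

instance (a b : Fin m → ℝ) (j : Fin m) : CompactSpace (nbrSet a b j) :=
  isCompact_iff_compactSpace.1 (isCompact_iUnion fun _ => isCompact_Icc)

/-- `𝒞⁺(Δ)`: vectors `(f_j)` of positive continuous functions, `f_j` on `Δ_{j-1} ∪ Δ_{j+1}`. -/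
@[ext]
structure PosVec (a b : Fin m → ℝ) where
  toFun : (j : Fin m) → C(nbrSet a b j, ℝ)
  pos : ∀ j x, 0 < toFun j x

variable {a b : Fin m → ℝ}

/-- `d(f, g) = max_j sup |ln (f_j / g_j)|`, the supremum being over `Δ_{j-1} ∪ Δ_{j+1}`. -/
def logSupDist (f g : PosVec a b) : ℝ :=
  ⨆ j : Fin m, ⨆ x : nbrSet a b j, |Real.log (f.toFun j x / g.toFun j x)|

/-- The componentwise logarithm. -/
def PosVec.log (f : PosVec a b) : (j : Fin m) → C(nbrSet a b j, ℝ) := fun j =>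
  ⟨fun x => Real.log (f.toFun j x), (f.toFun j).continuous.log fun x => (f.pos j x).ne'⟩

theorem PosVec.log_injective : Function.Injective (PosVec.log (a := a) (b := b)) := by
  intro f g h
  ext j x
  exact Real.log_injOn_pos (f.pos j x) (g.pos j x) (DFunLike.congr_fun (congrFun h j) x)

theorem logSupDist_eq (f g : PosVec a b) : logSupDist f g = dist f.log g.log := by
  have key : ∀ j, ⨆ x : nbrSet a b j, |Real.log (f.toFun j x / g.toFun j x)|
      = dist (f.log j) (g.log j) := by
    intro j
    rw [dist_eq_norm, ContinuousMap.norm_eq_iSup_norm]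
    refine iSup_congr fun x => ?_
    rw [Real.log_div (f.pos j x).ne' (g.pos j x).ne', Real.norm_eq_abs]
    rfl
  unfold logSupDist
  simp only [key]
  apply le_antisymm
  · exact Real.iSup_le (fun j => dist_le_pi_dist _ _ j) dist_nonneg
  · exact (dist_pi_le_iff (Real.iSup_nonneg fun j => dist_nonneg)).2 fun j =>
      le_ciSup (f := fun j => dist (f.log j) (g.log j)) (finite_range _).bddAbove j

/-- `𝒞⁺(Δ)` with the metric `d`. -/
instance : MetricSpace (PosVec a b) where
  dist := logSupDist
  dist_self f := by simp [logSupDist_eq]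
  dist_comm f g := by simp [logSupDist_eq, dist_comm]
  dist_triangle f g h := by simpa [logSupDist_eq] using dist_triangle _ _ _
  eq_of_dist_eq_zero {f g} h := by
    have h' : logSupDist f g = 0 := h
    rw [logSupDist_eq] at h'
    exact PosVec.log_injective (dist_eq_zero.1 h')

/-! ### The operator -/

/-- `f_{j-1}(x) f_{j+1}(x)` for `x ∈ Δ_j`, with the convention that a factor whose index is out
of range is `1`. -/
def nbrProd (f : PosVec a b) (j : Fin m) (x : ℝ) (hx : x ∈ Icc (a j) (b j)) : ℝ :=
  ∏ i : {i : Fin m // Adj i j}, f.toFun i ⟨x, mem_nbrSet i.2 hx⟩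

/-- The graph of the operator: each component `g_j` is the restriction to `Δ_{j-1} ∪ Δ_{j+1}` of
a Szegő function `G` on the complement of `Δ_j` whose boundary values, taken along vertical
lines from above and from below, satisfy `|G(x)|² = f_{j-1}(x) f_{j+1}(x) / w_j(x)` for almost
every `x ∈ Δ_j`. -/
def IsImage (w : Fin m → ℝ → ℝ) (f g : PosVec a b) : Prop :=
  ∀ j : Fin m, ∃ G : ℂ → ℂ, IsSzegoFun (a j) (b j) G ∧
    (∀ᵐ x : ℝ, ∀ hx : x ∈ Icc (a j) (b j),
      Tendsto (fun y : ℝ => ‖G ((x : ℂ) + (y : ℂ) * Complex.I)‖ ^ 2) (𝓝[≠] 0)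
        (𝓝 (nbrProd f j x hx / w j x))) ∧
    ∀ x : nbrSet a b j, G ((x : ℝ) : ℂ) = ((g.toFun j x : ℝ) : ℂ)

/-- `⌈m / 2⌉`. -/
def ceilHalf (m : ℕ) : ℕ := (m + 1) / 2

/-- The contraction constant. -/
def contractionConst (m : ℕ) : ℝ :=
  if Even m then ((2 : ℝ) ^ ceilHalf m - 1) / 2 ^ ceilHalf m
  else ((2 : ℝ) ^ ceilHalf m - 2) / 2 ^ ceilHalf m

end

end Szego

/-!
The logarithm turns `𝒞⁺(Δ)` with `d` into a finite product of spaces `C(K, ℝ)` with the supremum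
metric (`isometry_log`, `surjective_log`), whence completeness.

*The operator.* The Szegő function of `h dη` satisfies `|G_±|² = 1 / h` almost everywhere
(`ae_tendsto_norm_sq_szegoFun`): above `x ∈ (a, b)` the root is `i √((b - x)(x - a)) + O(y)`, which
reduces `ln |G|²` to the Poisson integral of `ln h / √((b - t)(t - a))`, and Poisson integrals of
integrable functions have vertical limits almost everywhere (`ae_tendsto_integral_poisson`, from
Lebesgue's differentiation theorem). Hence the boundary condition determines the weight almost
everywhere, and `T_j f` has to be the Szegő function of `w_j / (f_{j-1} f_{j+1})`.

*Contraction.* In `ln T_j f - ln T_j g` the weight `w_j` cancels. Since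
`√((x - a)(x - b)) ∫ dη(t) / |t - x| = π` for real `x` off `[a, b]`
(`integral_eta_inv_abs_sub`), the componentwise distances satisfy
`d_j(T f, T g) ≤ (d_{j-1}(f, g) + d_{j+1}(f, g)) / 2`, a missing neighbour counting as `0`
(`dist_log_szegoOp_le`). This is the transition matrix of the simple random walk on `m` sites with
an exit at either end, so after `k` steps the constant at site `j` is the probability of not having
left. For `k = ⌈m/2⌉` the straight walks to the exits within reach have total probability at least
`2⁻ᵏ` for even `m` and at least `2 · 2⁻ᵏ` for odd `m` (`one_sub_exitBound_le`), which gives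
`γ_m`. Banach's theorem for the iterate gives the fixed point.
-/

/-! ### Vertical limits of Poisson integrals on the line -/

namespace Szego

theorem tendsto_inv_sq_add_atTop (y : ℝ) :
    Tendsto (fun s : ℝ => -(y / (s ^ 2 + y ^ 2))) atTop (𝓝 0) := by
  have h : Tendsto (fun s : ℝ => s ^ 2 + y ^ 2) atTop atTop :=
    tendsto_atTop_add_const_right _ _ (tendsto_pow_atTop two_ne_zero)
  simpa using (h.const_div_atTop y).neg

theorem hasDerivAt_neg_poisson {y : ℝ} (hy : 0 < y) (s : ℝ) :
    HasDerivAt (fun s : ℝ => -(y / (s ^ 2 + y ^ 2))) (2 * y * s / (s ^ 2 + y ^ 2) ^ 2) s := by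
  have h0 : s ^ 2 + y ^ 2 ≠ 0 := by positivity
  have h1 : HasDerivAt (fun s : ℝ => s ^ 2 + y ^ 2) (2 * s) s := by
    simpa using (hasDerivAt_pow 2 s).add_const (y ^ 2)
  refine ((hasDerivAt_const s y).div h1 h0).neg.congr_deriv ?_
  field_simp
  ring

theorem integrableOn_layer {y c : ℝ} (hy : 0 < y) (hc : 0 ≤ c) :
    IntegrableOn (fun s : ℝ => 2 * y * s / (s ^ 2 + y ^ 2) ^ 2) (Ioi c) :=
  integrableOn_Ioi_deriv_of_nonneg' (fun s _ => hasDerivAt_neg_poisson hy s)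
    (fun s hs => by have : 0 < s := hc.trans_lt hs; positivity) (tendsto_inv_sq_add_atTop y)

theorem integral_layer {y c : ℝ} (hy : 0 < y) (hc : 0 ≤ c) :
    ∫ s in Ioi c, 2 * y * s / (s ^ 2 + y ^ 2) ^ 2 = y / (c ^ 2 + y ^ 2) := by
  rw [integral_Ioi_of_hasDerivAt_of_nonneg' (fun s _ => hasDerivAt_neg_poisson hy s)
    (fun s hs => by have : 0 < s := hc.trans_lt hs; positivity) (tendsto_inv_sq_add_atTop y)]
  simp

/-- The Poisson kernel is a superposition of indicator functions of centred intervals, so a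
Poisson integral is a weighted mean of integrals over balls. -/
theorem integral_mul_poisson_eq {φ : ℝ → ℝ} (hφ : Integrable φ) (x : ℝ) {y : ℝ} (hy : 0 < y) :
    ∫ t, φ t * (y / ((t - x) ^ 2 + y ^ 2)) =
      ∫ s in Ioi (0 : ℝ), 2 * y * s / (s ^ 2 + y ^ 2) ^ 2 * ∫ t in Metric.closedBall x s, φ t := by
  set k : ℝ → ℝ := fun s => 2 * y * s / (s ^ 2 + y ^ 2) ^ 2
  set S : Set (ℝ × ℝ) := {p | |p.1 - x| < p.2}
  have hS : MeasurableSet S := (isOpen_lt (by fun_prop) (by fun_prop)).measurableSet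
  have hint : Integrable (S.indicator fun p : ℝ × ℝ => φ p.1 * k p.2)
      (volume.prod (volume.restrict (Ioi 0))) :=
    (hφ.mul_prod (integrableOn_layer hy le_rfl)).indicator hS
  have hswap := integral_integral_swap
    (f := fun t s => S.indicator (fun p : ℝ × ℝ => φ p.1 * k p.2) (t, s)) hint
  have hl : ∀ t, ∫ s in Ioi (0 : ℝ), S.indicator (fun p : ℝ × ℝ => φ p.1 * k p.2) (t, s)
      = φ t * (y / ((t - x) ^ 2 + y ^ 2)) := by
    intro t
    have : (fun s => S.indicator (fun p : ℝ × ℝ => φ p.1 * k p.2) (t, s))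
        = (Ioi |t - x|).indicator fun s => φ t * k s := by
      ext s; simp [S, indicator]
    rw [this, setIntegral_indicator measurableSet_Ioi,
      inter_eq_self_of_subset_right (Ioi_subset_Ioi (abs_nonneg _)), integral_const_mul,
      integral_layer hy (abs_nonneg _), sq_abs]
  have hr : ∀ s, ∫ t, S.indicator (fun p : ℝ × ℝ => φ p.1 * k p.2) (t, s)
      = k s * ∫ t in Metric.closedBall x s, φ t := by
    intro s
    have : (fun t => S.indicator (fun p : ℝ × ℝ => φ p.1 * k p.2) (t, s))
        = (Metric.ball x s).indicator fun t => k s * φ t := by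
      ext t; simp [S, indicator, Real.dist_eq, mul_comm]
    rw [this, integral_indicator Metric.isOpen_ball.measurableSet, integral_const_mul,
      Real.ball_eq_Ioo, Real.closedBall_eq_Icc, setIntegral_congr_set Ioo_ae_eq_Icc]
  simp only [hl, hr] at hswap
  exact hswap

theorem hasDerivAt_arctan_sub (u : ℝ) :
    HasDerivAt (fun u : ℝ => 2 * (Real.arctan u - u / (1 + u ^ 2)))
      (4 * u ^ 2 / (1 + u ^ 2) ^ 2) u := by
  have h0 : 1 + u ^ 2 ≠ 0 := by positivity
  have h1 : HasDerivAt (fun s : ℝ => 1 + s ^ 2) (2 * u) u := by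
    simpa using (hasDerivAt_pow 2 u).const_add 1
  refine (((Real.hasDerivAt_arctan u).sub
    ((hasDerivAt_id' u).div h1 h0)).const_mul 2).congr_deriv ?_
  field_simp
  ring

theorem tendsto_arctan_sub :
    Tendsto (fun u : ℝ => 2 * (Real.arctan u - u / (1 + u ^ 2))) atTop (𝓝 Real.pi) := by
  have h : Tendsto (fun u : ℝ => u / (1 + u ^ 2)) atTop (𝓝 0) := by
    refine squeeze_zero' (g := fun u : ℝ => u⁻¹) ?_ ?_ tendsto_inv_atTop_zero
    · filter_upwards [eventually_gt_atTop 0] with u hu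
      positivity
    · filter_upwards [eventually_gt_atTop 0] with u hu
      rw [div_le_iff₀ (by positivity)]
      field_simp
      nlinarith
  have := (((Real.tendsto_arctan_atTop.mono_right nhdsWithin_le_nhds).sub h).const_mul 2)
  convert this using 2
  ring

/-- Poisson integrals of an integrable function `φ` converge to `π φ` along almost every
vertical line. -/
theorem ae_tendsto_integral_poisson {φ : ℝ → ℝ} (hφ : Integrable φ) :
    ∀ᵐ x : ℝ, Tendsto (fun y : ℝ => ∫ t, φ t * (y / ((t - x) ^ 2 + y ^ 2))) (𝓝[>] 0)
      (𝓝 (Real.pi * φ x)) := by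
  filter_upwards [IsUnifLocDoublingMeasure.ae_tendsto_average (μ := (volume : Measure ℝ))
    hφ.locallyIntegrable 1] with x hx
  have hx : Tendsto (fun s => ⨍ t in Metric.closedBall x s, φ t) (𝓝[>] 0) (𝓝 (φ x)) :=
    hx (fun _ => x) id tendsto_id (by
      filter_upwards [self_mem_nhdsWithin] with s hs
      simpa using (le_of_lt hs : (0 : ℝ) ≤ s))
  set A : ℝ → ℝ := fun s => ⨍ t in Metric.closedBall x s, φ t
  have hA : ∀ s, 0 < s → ∫ t in Metric.closedBall x s, φ t = 2 * s * A s := by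
    intro s hs
    simp only [A, setAverage_eq, measureReal_def, Real.volume_closedBall, smul_eq_mul]
    rw [ENNReal.toReal_ofReal (by positivity)]
    field_simp
  -- the means over balls are bounded: near `0` because they converge, away from it by `‖φ‖₁`
  obtain ⟨C, hC⟩ : ∃ C, ∀ s, 0 < s → |A s| ≤ C := by
    obtain ⟨δ, hδ, hb⟩ : ∃ δ > 0, ∀ s ∈ Ioo 0 δ, |A s| < |φ x| + 1 := by
      have := hx.abs.eventually (gt_mem_nhds (lt_add_one |φ x|))
      obtain ⟨δ, hδ, h⟩ := mem_nhdsGT_iff_exists_Ioo_subset.1 this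
      exact ⟨δ, hδ, fun s hs => h hs⟩
    refine ⟨max (|φ x| + 1) ((∫ t, |φ t|) / (2 * δ)), fun s hs => ?_⟩
    rcases lt_or_ge s δ with h | h
    · exact (hb s ⟨hs, h⟩).le.trans (le_max_left _ _)
    · refine le_trans ?_ (le_max_right _ _)
      have h1 : |2 * s * A s| ≤ ∫ t, |φ t| := by
        rw [← hA s hs]
        refine abs_integral_le_integral_abs.trans ?_
        exact setIntegral_le_integral hφ.abs (Eventually.of_forall fun t => abs_nonneg _)
      rw [abs_mul, abs_of_pos (by positivity)] at h1
      have hδ' : 0 < δ := hδ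
      rw [le_div_iff₀ (by positivity)]
      nlinarith [abs_nonneg (A s)]
  have hscale : ∀ y : ℝ, 0 < y → ∫ t, φ t * (y / ((t - x) ^ 2 + y ^ 2))
      = ∫ u in Ioi (0 : ℝ), 4 * u ^ 2 / (1 + u ^ 2) ^ 2 * A (y * u) := by
    intro y hy
    rw [integral_mul_poisson_eq hφ x hy]
    have := integral_comp_mul_left_Ioi (fun s => 2 * y * s / (s ^ 2 + y ^ 2) ^ 2 *
      ∫ t in Metric.closedBall x s, φ t) 0 hy
    rw [mul_zero, smul_eq_mul, eq_inv_mul_iff_mul_eq₀ hy.ne'] at this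
    rw [← this, ← integral_const_mul]
    refine setIntegral_congr_fun measurableSet_Ioi fun u hu => ?_
    have hu : 0 < u := hu
    rw [hA _ (mul_pos hy hu)]
    field_simp
    ring
  have hint : IntegrableOn (fun u : ℝ => 4 * u ^ 2 / (1 + u ^ 2) ^ 2) (Ioi 0) :=
    integrableOn_Ioi_deriv_of_nonneg' (fun s _ => hasDerivAt_arctan_sub s)
      (fun s hs => by positivity) tendsto_arctan_sub
  have hval : ∫ u in Ioi (0 : ℝ), 4 * u ^ 2 / (1 + u ^ 2) ^ 2 * φ x = Real.pi * φ x := by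
    rw [integral_mul_const, integral_Ioi_of_hasDerivAt_of_nonneg'
      (fun s _ => hasDerivAt_arctan_sub s) (fun s hs => by positivity) tendsto_arctan_sub]
    simp
  rw [← hval]
  have hAc : Continuous fun s => ∫ t in (x - s)..(x + s), φ t := by
    have h := intervalIntegral.continuous_primitive (fun a b => hφ.intervalIntegrable) x
    have : (fun s => ∫ t in (x - s)..(x + s), φ t)
        = fun s => (∫ t in x..(x + s), φ t) - ∫ t in x..(x - s), φ t := by
      ext s
      rw [intervalIntegral.integral_interval_sub_left] <;> exact hφ.intervalIntegrable
    rw [this]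
    exact (h.comp (by fun_prop)).sub (h.comp (by fun_prop))
  have hAm : ∀ y : ℝ, 0 < y →
      AEStronglyMeasurable (fun u => A (y * u)) (volume.restrict (Ioi 0)) := by
    intro y hy
    have h1 : Measurable fun u : ℝ => (∫ t in (x - y * u)..(x + y * u), φ t) / (2 * (y * u)) :=
      ((hAc.comp (by fun_prop : Continuous fun u => y * u)).measurable).div (by fun_prop)
    refine h1.aestronglyMeasurable.congr ?_
    filter_upwards [ae_restrict_mem measurableSet_Ioi] with u hu
    have hyu : 0 < y * u := mul_pos hy hu
    have := hA _ hyu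
    rw [Real.closedBall_eq_Icc, integral_Icc_eq_integral_Ioc,
      ← intervalIntegral.integral_of_le (by linarith)] at this
    rw [this, mul_div_cancel_left₀ _ (by positivity)]
  have hlim : Tendsto (fun y : ℝ => ∫ u in Ioi (0 : ℝ), 4 * u ^ 2 / (1 + u ^ 2) ^ 2 * A (y * u))
      (𝓝[>] 0) (𝓝 (∫ u in Ioi (0 : ℝ), 4 * u ^ 2 / (1 + u ^ 2) ^ 2 * φ x)) := by
    refine tendsto_integral_filter_of_dominated_convergence
      (fun u => 4 * u ^ 2 / (1 + u ^ 2) ^ 2 * C) ?_ ?_ (hint.mul_const C) ?_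
    · filter_upwards [self_mem_nhdsWithin] with y hy
      exact hint.aestronglyMeasurable.mul (hAm y hy)
    · filter_upwards [self_mem_nhdsWithin] with y hy
      filter_upwards [ae_restrict_mem measurableSet_Ioi] with u hu
      rw [norm_mul, Real.norm_eq_abs, Real.norm_eq_abs, abs_of_nonneg (by positivity)]
      exact mul_le_mul_of_nonneg_left (hC _ (mul_pos hy hu)) (by positivity)
    · filter_upwards [ae_restrict_mem measurableSet_Ioi] with u hu
      refine (hx.comp ?_).const_mul _
      refine tendsto_nhdsWithin_iff.2 ⟨?_, ?_⟩
      · have : Tendsto (fun y : ℝ => y * u) (𝓝 0) (𝓝 (0 * u)) := tendsto_id.mul_const u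
        rw [zero_mul] at this
        exact this.mono_left nhdsWithin_le_nhds
      · filter_upwards [self_mem_nhdsWithin] with y hy
        exact mul_pos (show (0 : ℝ) < y from hy) hu
  refine hlim.congr' ?_
  filter_upwards [self_mem_nhdsWithin] with y hy
  exact (hscale y hy).symm

/-! ### The arcsine measure -/

theorem measurable_etaDensity (a b : ℝ) :
    Measurable fun x : ℝ => ENNReal.ofReal (1 / Real.sqrt ((b - x) * (x - a))) := by
  fun_prop

theorem integrable_eta_iff {E : Type*} [NormedAddCommGroup E] [NormedSpace ℝ E] {a b : ℝ}
    {f : ℝ → E} : Integrable f (eta a b) ↔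
      IntegrableOn (fun x => (1 / Real.sqrt ((b - x) * (x - a))) • f x) (Icc a b) := by
  rw [eta, integrable_withDensity_iff_integrable_smul' (measurable_etaDensity a b)
    (Eventually.of_forall fun _ => ENNReal.ofReal_lt_top), IntegrableOn]
  simp only [ENNReal.toReal_ofReal (one_div_nonneg.2 (Real.sqrt_nonneg _))]

theorem integral_eta {E : Type*} [NormedAddCommGroup E] [NormedSpace ℝ E] (a b : ℝ) (f : ℝ → E) :
    ∫ x, f x ∂(eta a b) = ∫ x in Icc a b, (1 / Real.sqrt ((b - x) * (x - a))) • f x := by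
  rw [eta, integral_withDensity_eq_integral_toReal_smul (measurable_etaDensity a b)
    (Eventually.of_forall fun _ => ENNReal.ofReal_lt_top)]
  simp only [ENNReal.toReal_ofReal (one_div_nonneg.2 (Real.sqrt_nonneg _))]

theorem ae_eta_iff {a b : ℝ} {p : ℝ → Prop} :
    (∀ᵐ x ∂(eta a b), p x) ↔ ∀ᵐ x, x ∈ Icc a b → p x := by
  rw [eta, ae_withDensity_iff (measurable_etaDensity a b), ae_restrict_iff' measurableSet_Icc]
  have h : ∀ᵐ x : ℝ, x ≠ a ∧ x ≠ b := by
    filter_upwards [Measure.ae_ne volume a, Measure.ae_ne volume b] with x h1 h2 using ⟨h1, h2⟩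
  constructor
  · intro H
    filter_upwards [H, h] with x hx hne hxI
    refine hx hxI ?_
    have h1 : 0 < x - a := sub_pos.2 (lt_of_le_of_ne hxI.1 hne.1.symm)
    have h2 : 0 < b - x := sub_pos.2 (lt_of_le_of_ne hxI.2 hne.2)
    rw [ne_eq, ENNReal.ofReal_eq_zero, not_le]
    positivity
  · intro H
    filter_upwards [H] with x hx hxI _ using hx hxI

theorem sub_mul_sub_pos_of_notMem_Icc {a b x : ℝ} (hab : a ≤ b) (hx : x ∉ Icc a b) :
    0 < (x - a) * (x - b) := by
  rcases lt_or_ge x a with h | h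
  · exact mul_pos_of_neg_of_neg (by linarith) (by linarith)
  · have : b < x := not_le.1 fun h' => hx ⟨h, h'⟩
    exact mul_pos (by linarith) (by linarith)

/-- For `x` off `[a, b]`, an antiderivative of the Cauchy kernel `1 / |t - x|` against the arcsine
density, up to the factor `√((x - a)(x - b))`: the arcsine of the Möbius map that takes `a`, `b`,
`x` to `-1`, `1`, `∞`. -/
theorem hasDerivAt_arcsin_moebius {a b x t : ℝ} (hx : x ∉ Icc a b) (ht : t ∈ Ioo a b) :
    HasDerivAt (fun t => Real.arcsin (2 * ((x - b) * (t - a) / ((x - t) * (b - a))) - 1))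
      (Real.sqrt ((x - a) * (x - b)) * (1 / Real.sqrt ((b - t) * (t - a)) * (1 / |t - x|))) t := by
  have hab : a < b := ht.1.trans ht.2
  have hP := sub_mul_sub_pos_of_notMem_Icc hab.le hx
  have hxt : x - t ≠ 0 := fun h => hx (by rw [sub_eq_zero.1 h]; exact ⟨ht.1.le, ht.2.le⟩)
  have hba : 0 < b - a := sub_pos.2 hab
  have h1 : 0 < t - a := sub_pos.2 ht.1
  have h2 : 0 < b - t := sub_pos.2 ht.2
  set y : ℝ → ℝ := fun t => 2 * ((x - b) * (t - a) / ((x - t) * (b - a))) - 1 with hy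
  have hy1 : 1 - y t ^ 2 = 4 * ((x - a) * (x - b)) * ((b - t) * (t - a)) /
      (|t - x| * (b - a)) ^ 2 := by
    rw [mul_pow, sq_abs, show (t - x) ^ 2 = (x - t) ^ 2 by ring]
    simp only [hy]
    field_simp
    ring
  have hy0 : 0 < 1 - y t ^ 2 := by
    rw [hy1]
    have : 0 < |t - x| := abs_pos.2 fun h => hxt (by linarith)
    positivity
  have hd : HasDerivAt y (2 * ((x - a) * (x - b)) / (|t - x| ^ 2 * (b - a))) t := by
    have e1 : HasDerivAt (fun t => (x - b) * (t - a)) (x - b) t := by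
      simpa using ((hasDerivAt_id' t).sub_const a).const_mul (x - b)
    have e2 : HasDerivAt (fun t => (x - t) * (b - a)) (-(b - a)) t := by
      simpa using ((hasDerivAt_id' t).const_sub x).mul_const (b - a)
    refine (((e1.div e2 (mul_ne_zero hxt hba.ne')).const_mul 2).sub_const 1).congr_deriv ?_
    rw [sq_abs, show (t - x) ^ 2 = (x - t) ^ 2 by ring]
    field_simp
    ring
  have hs : Real.sqrt (1 - y t ^ 2) = 2 * Real.sqrt ((x - a) * (x - b)) *
      Real.sqrt ((b - t) * (t - a)) / (|t - x| * (b - a)) := by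
    rw [hy1, Real.sqrt_div (by positivity), Real.sqrt_sq (by positivity),
      Real.sqrt_mul (by positivity), Real.sqrt_mul (by positivity)]
    congr 3
    rw [show (4 : ℝ) = 2 ^ 2 by norm_num, Real.sqrt_sq (by norm_num)]
  have h3 : y t ≠ -1 := fun h => by rw [h] at hy0; norm_num at hy0
  have h4 : y t ≠ 1 := fun h => by rw [h] at hy0; norm_num at hy0
  refine ((Real.hasDerivAt_arcsin h3 h4).comp t hd).congr_deriv ?_
  rw [hs]
  have : 0 < |t - x| := abs_pos.2 fun h => hxt (by linarith)
  have hS : 0 < Real.sqrt ((x - a) * (x - b)) := Real.sqrt_pos.2 hP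
  have hR : 0 < Real.sqrt ((b - t) * (t - a)) := by positivity
  nth_rewrite 2 [← Real.mul_self_sqrt hP.le]
  field_simp

theorem continuousOn_arcsin_moebius {a b x : ℝ} (hab : a < b) (hx : x ∉ Icc a b) :
    ContinuousOn (fun t => Real.arcsin (2 * ((x - b) * (t - a) / ((x - t) * (b - a))) - 1))
      (Icc a b) := by
  refine Real.continuous_arcsin.comp_continuousOn ?_
  have h : ContinuousOn (fun t => (x - b) * (t - a) / ((x - t) * (b - a))) (Icc a b) := by
    refine ContinuousOn.div (by fun_prop) (by fun_prop) fun t ht => ?_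
    exact mul_ne_zero (fun h => hx (by rwa [sub_eq_zero.1 h])) (sub_pos.2 hab).ne'
  fun_prop

theorem integrable_eta_inv_abs_sub {a b x : ℝ} (hab : a < b) (hx : x ∉ Icc a b) :
    Integrable (fun t => 1 / |t - x|) (eta a b) := by
  rw [integrable_eta_iff, integrableOn_Icc_iff_integrableOn_Ioc]
  have hS : 0 < Real.sqrt ((x - a) * (x - b)) :=
    Real.sqrt_pos.2 (sub_mul_sub_pos_of_notMem_Icc hab.le hx)
  have := intervalIntegral.integrableOn_deriv_of_nonneg (continuousOn_arcsin_moebius hab hx)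
    (fun t ht => hasDerivAt_arcsin_moebius hx ht) (fun t ht => by positivity)
  exact (integrable_const_mul_iff (Ne.isUnit hS.ne') _).1 this

theorem integral_eta_inv_abs_sub {a b x : ℝ} (hab : a < b) (hx : x ∉ Icc a b) :
    Real.sqrt ((x - a) * (x - b)) * ∫ t, 1 / |t - x| ∂(eta a b) = Real.pi := by
  rw [integral_eta, ← integral_const_mul, integral_Icc_eq_integral_Ioc,
    ← intervalIntegral.integral_of_le hab.le]
  simp only [smul_eq_mul]
  have hint := intervalIntegral.integrableOn_deriv_of_nonneg (continuousOn_arcsin_moebius hab hx)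
    (fun t ht => hasDerivAt_arcsin_moebius hx ht) (fun t ht => by positivity)
  rw [intervalIntegral.integral_eq_sub_of_hasDerivAt_of_le hab.le
    (continuousOn_arcsin_moebius hab hx) (fun t ht => hasDerivAt_arcsin_moebius hx ht)
    ((intervalIntegrable_iff_integrableOn_Ioc_of_le hab.le).2 hint)]
  have h1 : x - b ≠ 0 := fun h => hx (by rw [sub_eq_zero.1 h]; exact right_mem_Icc.2 hab.le)
  have h2 : b - a ≠ 0 := (sub_pos.2 hab).ne'
  rw [div_self (mul_ne_zero h1 h2)]
  norm_num

theorem isFiniteMeasure_eta {a b : ℝ} (hab : a < b) : IsFiniteMeasure (eta a b) := by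
  -- `1 ≤ (b + 1 - a) / |t - (b + 1)|` on `[a, b]`
  have h := (integrable_eta_inv_abs_sub (x := b + 1) hab (by simp)).const_mul (b + 1 - a)
  have h1 : Integrable (fun _ : ℝ => (1 : ℝ)) (eta a b) := by
    refine h.mono' aestronglyMeasurable_const (ae_eta_iff.2 (Eventually.of_forall fun t ht => ?_))
    have : |t - (b + 1)| = b + 1 - t := by rw [abs_of_neg (by linarith [ht.2])]; ring
    rw [this, norm_one, mul_one_div, le_div_iff₀ (by linarith [ht.2])]
    linarith [ht.1]
  exact (integrable_const_iff_isFiniteMeasure one_ne_zero).1 h1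

/-! ### Boundary values of Szegő functions -/

theorem branchSqrt_sq {a b : ℝ} {z : ℂ} (hz : z ≠ a) :
    branchSqrt a b z ^ 2 = (z - a) * (z - b) := by
  have h : z - a ≠ 0 := sub_ne_zero.2 hz
  have := Complex.cpow_nat_inv_pow ((z - b) / (z - a)) two_ne_zero
  rw [branchSqrt, mul_pow, one_div]
  push_cast at this
  rw [this]
  field_simp

theorem im_moebius (a b x y : ℝ) :
    ((((x : ℂ) + y * Complex.I) - b) / (((x : ℂ) + y * Complex.I) - a)).im
      = y * (b - a) / ((x - a) ^ 2 + y ^ 2) := by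
  rw [Complex.div_im]
  simp [Complex.normSq_apply]
  ring

/-- Above a point of `(a, b)` the branch of the root differs from its boundary value
`i √((b - x)(x - a))` by `O(y)`. -/
theorem norm_branchSqrt_sub_le {a b x y : ℝ} (hx : x ∈ Ioo a b) (hy : 0 < y) :
    ‖branchSqrt a b (x + y * Complex.I) - Real.sqrt ((b - x) * (x - a)) * Complex.I‖
      ≤ y * ((b - a + y) / Real.sqrt ((b - x) * (x - a))) := by
  set z : ℂ := x + y * Complex.I with hz
  set s := branchSqrt a b z with hs
  set r := Real.sqrt ((b - x) * (x - a)) with hr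
  have h1 : 0 < x - a := sub_pos.2 hx.1
  have h2 : 0 < b - x := sub_pos.2 hx.2
  have hrpos : 0 < r := by positivity
  have hr2 : r ^ 2 = (b - x) * (x - a) := Real.sq_sqrt (by positivity)
  have hw : 0 ≤ ((z - b) / (z - a)).im := by
    rw [hz, im_moebius]
    have : 0 < b - a := by linarith
    positivity
  have hsim : 0 ≤ s.im := by
    rw [hs, branchSqrt, one_div, Complex.mul_im, Complex.cpow_inv_two_re,
      Complex.cpow_inv_two_im_eq_sqrt hw]
    simp only [hz]
    simp
    positivity
  have hza : z ≠ a := fun h => by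
    have := congrArg Complex.im h
    simp [hz] at this
    exact hy.ne' this
  have hprod : (s - r * Complex.I) * (s + r * Complex.I)
      = y * ((2 * x - a - b : ℝ) * Complex.I - y) := by
    have : (s - r * Complex.I) * (s + r * Complex.I) = s ^ 2 + (r ^ 2 : ℝ) := by
      push_cast
      linear_combination (-(r : ℂ) ^ 2) * Complex.I_sq
    rw [this, hs, branchSqrt_sq hza, hr2, hz]
    push_cast
    linear_combination (y : ℂ) ^ 2 * Complex.I_sq
  have hnorm : ‖s - r * Complex.I‖ * ‖s + r * Complex.I‖ ≤ y * (b - a + y) := by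
    rw [← norm_mul, hprod, norm_mul, Complex.norm_real, Real.norm_eq_abs, abs_of_pos hy]
    refine mul_le_mul_of_nonneg_left ((norm_sub_le _ _).trans ?_) hy.le
    rw [norm_mul, Complex.norm_I, mul_one, Complex.norm_real, Complex.norm_real, Real.norm_eq_abs,
      Real.norm_eq_abs, abs_of_pos hy]
    gcongr
    rw [abs_le]
    constructor <;> linarith
  have hplus : r ≤ ‖s + r * Complex.I‖ := by
    refine le_trans ?_ ((le_abs_self _).trans (Complex.abs_im_le_norm _))
    simpa using hsim
  rw [← mul_div_assoc, le_div_iff₀ hrpos]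
  exact (mul_le_mul_of_nonneg_left hplus (norm_nonneg _)).trans hnorm

theorem le_norm_ofReal_sub (x t : ℝ) {y : ℝ} (hy : 0 < y) :
    y ≤ ‖(t : ℂ) - (x + y * Complex.I)‖ := by
  refine le_trans ?_ (Complex.abs_im_le_norm _)
  simp [abs_of_pos hy]

theorem integrable_cauchy {μ : Measure ℝ} {L : ℝ → ℝ} (hL : Integrable L μ) (x : ℝ) {y : ℝ}
    (hy : 0 < y) : Integrable (fun t => (L t : ℂ) / ((t : ℂ) - (x + y * Complex.I))) μ := by
  simp only [div_eq_mul_inv]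
  refine hL.ofReal.mul_bdd (c := y⁻¹) (by fun_prop) (Eventually.of_forall fun t => ?_)
  rw [norm_inv]
  exact inv_anti₀ hy (le_norm_ofReal_sub x t hy)

theorem im_integral_cauchy {μ : Measure ℝ} {L : ℝ → ℝ} (hL : Integrable L μ) (x : ℝ) {y : ℝ}
    (hy : 0 < y) : (∫ t, (L t : ℂ) / ((t : ℂ) - (x + y * Complex.I)) ∂μ).im
      = ∫ t, L t * (y / ((t - x) ^ 2 + y ^ 2)) ∂μ := by
  have h := Complex.imCLM.integral_comp_comm (integrable_cauchy hL x hy)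
  simp only [Complex.imCLM_apply] at h
  rw [← h]
  refine integral_congr_ae (Eventually.of_forall fun t => ?_)
  simp [Complex.div_im, Complex.normSq_apply]
  ring

/-- A Cauchy integral grows slower than `1 / y` above a point without mass. -/
theorem tendsto_mul_norm_integral_cauchy {μ : Measure ℝ} {L : ℝ → ℝ} (hL : Integrable L μ) {x : ℝ}
    (hx : ∀ᵐ t ∂μ, t ≠ x) :
    Tendsto (fun y : ℝ => y * ‖∫ t, (L t : ℂ) / ((t : ℂ) - (x + y * Complex.I)) ∂μ‖)
      (𝓝[>] 0) (𝓝 0) := by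
  have h : Tendsto (fun y : ℝ => ∫ t, (y : ℂ) * ((L t : ℂ) / ((t : ℂ) - (x + y * Complex.I))) ∂μ)
      (𝓝[>] 0) (𝓝 (∫ _, (0 : ℂ) ∂μ)) := by
    refine tendsto_integral_filter_of_dominated_convergence (fun t => |L t|) ?_ ?_ hL.abs ?_
    · filter_upwards [self_mem_nhdsWithin] with y hy
      exact ((integrable_cauchy hL x hy).const_mul _).aestronglyMeasurable
    · filter_upwards [self_mem_nhdsWithin] with y hy
      refine Eventually.of_forall fun t => ?_
      have hy : 0 < y := hy
      have h1 := le_norm_ofReal_sub x t hy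
      rw [norm_mul, norm_div, Complex.norm_real, Complex.norm_real, Real.norm_eq_abs,
        Real.norm_eq_abs, abs_of_pos hy, mul_div_left_comm]
      exact mul_le_of_le_one_right (abs_nonneg _) ((div_le_one (hy.trans_le h1)).2 h1)
    · filter_upwards [hx] with t ht
      have hc : ContinuousAt (fun y : ℝ => (y : ℂ) * ((L t : ℂ) / ((t : ℂ) - (x + y * Complex.I))))
          0 := by
        refine ContinuousAt.mul (by fun_prop) (ContinuousAt.div (by fun_prop) (by fun_prop) ?_)
        simpa [sub_eq_zero] using ht
      have := hc.tendsto
      simp only [Complex.ofReal_zero, zero_mul] at this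
      exact this.mono_left nhdsWithin_le_nhds
  rw [integral_zero] at h
  have h' := h.norm
  rw [norm_zero] at h'
  refine h'.congr' ?_
  filter_upwards [self_mem_nhdsWithin] with y hy
  rw [integral_const_mul, norm_mul, Complex.norm_real, Real.norm_eq_abs,
    abs_of_pos (show (0 : ℝ) < y from hy)]

theorem norm_sq_szegoFun (a b : ℝ) (h : ℝ → ℝ) (z : ℂ) :
    ‖szegoFun a b h z‖ ^ 2 = Real.exp ((branchSqrt a b z *
      ∫ x, ((Real.log (h x) : ℝ) : ℂ) / ((x : ℂ) - z) ∂(eta a b)).re / Real.pi) := by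
  rw [szegoFun, Complex.norm_exp, ← Real.exp_nat_mul]
  congr 1
  have : ∀ s F : ℂ, s / (2 * (Real.pi : ℂ)) * F = ((2 * Real.pi : ℝ)⁻¹ : ℝ) * (s * F) := by
    intro s F
    push_cast
    ring
  rw [this, Complex.re_ofReal_mul]
  have := Real.pi_pos.ne'
  push_cast
  field_simp

/-- Off the real line, `G (conj z) = conj (G z)`. -/
theorem szegoFun_conj {a b : ℝ} (hab : a < b) (h : ℝ → ℝ) (x : ℝ) {y : ℝ} (hy : y ≠ 0) :
    szegoFun a b h (x + (-y : ℝ) * Complex.I)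
      = (starRingEnd ℂ) (szegoFun a b h (x + y * Complex.I)) := by
  set z : ℂ := x + y * Complex.I with hz
  have hzc : (x : ℂ) + (-y : ℝ) * Complex.I = (starRingEnd ℂ) z := by
    simp [hz]
  have him : ((z - b) / (z - a)).im ≠ 0 := by
    rw [hz, im_moebius]
    have : 0 < b - a := sub_pos.2 hab
    positivity
  have hs : branchSqrt a b ((starRingEnd ℂ) z) = (starRingEnd ℂ) (branchSqrt a b z) := by
    have harg : ((z - b) / (z - a)).arg ≠ Real.pi := fun H =>
      him (Complex.arg_eq_pi_iff.1 H).2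
    have := Complex.conj_cpow ((z - b) / (z - a)) (1 / 2) harg
    simp only [map_div₀, map_sub, Complex.conj_ofReal, map_one, Complex.conj_ofNat] at this
    simp only [branchSqrt, map_mul, map_sub, Complex.conj_ofReal, this]
  rw [hzc, szegoFun, szegoFun, hs, ← Complex.exp_conj, map_mul, map_div₀, ← integral_conj,
    map_mul, map_ofNat]
  simp

/-- Boundary values of a Szegő function: `|G_±(x)|² = 1 / h(x)` almost everywhere on `[a, b]`. -/
theorem ae_tendsto_norm_sq_szegoFun {a b : ℝ} (hab : a < b) {h : ℝ → ℝ}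
    (hh : LogIntegrable a b h) :
    ∀ᵐ x : ℝ, x ∈ Icc a b →
      Tendsto (fun y : ℝ => ‖szegoFun a b h ((x : ℂ) + (y : ℂ) * Complex.I)‖ ^ 2) (𝓝[≠] 0)
        (𝓝 (h x)⁻¹) := by
  set L : ℝ → ℝ := fun t => Real.log (h t)
  have hL : Integrable L (eta a b) := hh.2
  set φ : ℝ → ℝ := (Icc a b).indicator fun t => 1 / Real.sqrt ((b - t) * (t - a)) * L t
  have hφ : Integrable φ :=
    (integrable_indicator_iff measurableSet_Icc).2 (integrable_eta_iff.1 hL)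
  filter_upwards [ae_tendsto_integral_poisson hφ, ae_eta_iff.1 hh.1, Measure.ae_ne volume a,
    Measure.ae_ne volume b] with x hP hpos hxa hxb hxI
  have hx : x ∈ Ioo a b := ⟨lt_of_le_of_ne hxI.1 hxa.symm, lt_of_le_of_ne hxI.2 hxb⟩
  have hhx : 0 < h x := hpos hxI
  set r := Real.sqrt ((b - x) * (x - a))
  have hr : 0 < r := Real.sqrt_pos.2 (mul_pos (sub_pos.2 hx.2) (sub_pos.2 hx.1))
  set F : ℝ → ℂ := fun y => ∫ t, (L t : ℂ) / ((t : ℂ) - (x + y * Complex.I)) ∂(eta a b)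
  -- the imaginary part of the Cauchy integral is a Poisson integral
  have hIm : Tendsto (fun y => (F y).im) (𝓝[>] 0) (𝓝 (Real.pi * (1 / r * L x))) := by
    have hφx : φ x = 1 / r * L x := indicator_of_mem hxI _
    rw [← hφx]
    refine hP.congr' ?_
    filter_upwards [self_mem_nhdsWithin] with y hy
    rw [im_integral_cauchy hL x hy, integral_eta, ← integral_indicator measurableSet_Icc]
    refine integral_congr_ae (Eventually.of_forall fun t => ?_)
    by_cases ht : t ∈ Icc a b <;> simp [φ, ht, mul_assoc]
  have herr : Tendsto (fun y : ℝ => ((branchSqrt a b (x + y * Complex.I) - r * Complex.I) * F y).re)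
      (𝓝[>] 0) (𝓝 0) := by
    have hne : ∀ᵐ t ∂(eta a b), t ≠ x :=
      ae_eta_iff.2 ((Measure.ae_ne volume x).mono fun t ht _ => ht)
    have h1 : Tendsto (fun y : ℝ => (b - a + y) / r * (y * ‖F y‖)) (𝓝[>] 0)
        (𝓝 ((b - a + 0) / r * 0)) := by
      refine Tendsto.mul ?_ (tendsto_mul_norm_integral_cauchy hL hne)
      have : Continuous fun y : ℝ => (b - a + y) / r := by fun_prop
      exact (this.tendsto 0).mono_left nhdsWithin_le_nhds
    rw [mul_zero] at h1
    refine squeeze_zero_norm' ?_ h1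
    filter_upwards [self_mem_nhdsWithin] with y hy
    refine (Complex.abs_re_le_norm _).trans ?_
    rw [norm_mul]
    refine (mul_le_mul_of_nonneg_right (norm_branchSqrt_sub_le hx hy) (norm_nonneg _)).trans_eq ?_
    ring
  have hup : Tendsto (fun y : ℝ => ‖szegoFun a b h ((x : ℂ) + (y : ℂ) * Complex.I)‖ ^ 2) (𝓝[>] 0)
      (𝓝 (h x)⁻¹) := by
    have h1 : Tendsto (fun y : ℝ => Real.exp
        ((-(r * (F y).im) + ((branchSqrt a b (x + y * Complex.I) - r * Complex.I) * F y).re)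
          / Real.pi)) (𝓝[>] 0)
        (𝓝 (Real.exp ((-(r * (Real.pi * (1 / r * L x))) + 0) / Real.pi))) :=
      (Real.continuous_exp.tendsto _).comp
        ((((hIm.const_mul r).neg).add herr).div_const _)
    have h2 : (-(r * (Real.pi * (1 / r * L x))) + 0) / Real.pi = -Real.log (h x) := by
      have := Real.pi_pos.ne'
      simp only [L]
      field_simp
      ring
    rw [h2, Real.exp_neg, Real.exp_log hhx] at h1
    refine h1.congr fun y => ?_
    rw [norm_sq_szegoFun]
    congr 2
    rw [sub_mul, Complex.sub_re, mul_assoc (r : ℂ), Complex.re_ofReal_mul, Complex.I_mul_re]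
    simp only [F, L]
    ring
  have hdown : Tendsto (fun y : ℝ => ‖szegoFun a b h ((x : ℂ) + (y : ℂ) * Complex.I)‖ ^ 2) (𝓝[<] 0)
      (𝓝 (h x)⁻¹) := by
    have hneg : Tendsto (fun y : ℝ => -y) (𝓝[<] 0) (𝓝[>] 0) := by
      simpa using tendsto_neg_nhdsLT (a := (0 : ℝ))
    refine (hup.comp hneg).congr' ?_
    filter_upwards [self_mem_nhdsWithin] with y hy
    have := szegoFun_conj hab h x (ne_of_lt hy)
    simp only [Function.comp]
    rw [this, RCLike.norm_conj]
  rw [← nhdsLT_sup_nhdsGT]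
  exact hdown.sup hup

/-! ### Szegő functions on the real line off the interval -/

noncomputable section

/-- The exponent of the Szegő function with `ln h = L` at a real point `x` off `[a, b]`. -/
def logSzego (a b : ℝ) (L : ℝ → ℝ) (x : ℝ) : ℝ :=
  (x - a) * Real.sqrt ((x - b) / (x - a)) / (2 * Real.pi) * ∫ t, L t / (t - x) ∂(eta a b)

theorem div_sub_pos_of_notMem_Icc {a b x : ℝ} (hab : a ≤ b) (hx : x ∉ Icc a b) :
    0 < (x - b) / (x - a) := by
  have := sub_mul_sub_pos_of_notMem_Icc hab hx
  rw [mul_comm] at this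
  exact div_pos_iff.2 (mul_pos_iff.1 this)

theorem szegoFun_ofReal {a b x : ℝ} (hab : a ≤ b) (hx : x ∉ Icc a b) (h : ℝ → ℝ) :
    szegoFun a b h x = (Real.exp (logSzego a b (fun t => Real.log (h t)) x) : ℝ) := by
  have h1 : branchSqrt a b x = ((x - a) * Real.sqrt ((x - b) / (x - a)) : ℝ) := by
    rw [branchSqrt, Real.sqrt_eq_rpow, Complex.ofReal_mul,
      Complex.ofReal_cpow (div_sub_pos_of_notMem_Icc hab hx).le]
    push_cast
    rfl
  have h2 : ∫ t, ((Real.log (h t) : ℝ) : ℂ) / ((t : ℂ) - x) ∂(eta a b)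
      = ((∫ t, Real.log (h t) / (t - x) ∂(eta a b) : ℝ) : ℂ) := by
    rw [← integral_complex_ofReal]
    push_cast
    rfl
  rw [szegoFun, h1, h2, logSzego, Complex.ofReal_exp]
  push_cast
  rfl

theorem abs_sub_mul_sqrt_div {a b x : ℝ} (hab : a ≤ b) (hx : x ∉ Icc a b) :
    |(x - a) * Real.sqrt ((x - b) / (x - a))| = Real.sqrt ((x - a) * (x - b)) := by
  have h0 : x - a ≠ 0 := fun h => hx (by rw [sub_eq_zero.1 h]; exact left_mem_Icc.2 hab)
  rw [abs_mul, abs_of_nonneg (Real.sqrt_nonneg _), ← Real.sqrt_sq_eq_abs,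
    ← Real.sqrt_mul (sq_nonneg _)]
  congr 1
  field_simp

theorem le_abs_sub_of_ball_subset_compl {a b x δ : ℝ} (h : Metric.ball x δ ⊆ (Icc a b)ᶜ) {t : ℝ}
    (ht : t ∈ Icc a b) : δ ≤ |t - x| := by
  by_contra hlt
  exact h (show t ∈ Metric.ball x δ by simpa [Real.dist_eq] using hlt) ht

theorem integrable_div_sub {a b x : ℝ} (hx : x ∉ Icc a b) {L : ℝ → ℝ}
    (hL : Integrable L (eta a b)) : Integrable (fun t => L t / (t - x)) (eta a b) := by
  obtain ⟨δ, hδ, hball⟩ := Metric.isOpen_iff.1 isClosed_Icc.isOpen_compl x hx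
  simp only [div_eq_mul_inv]
  refine hL.mul_bdd (c := δ⁻¹) (by fun_prop)
    (ae_eta_iff.2 (Eventually.of_forall fun t ht => ?_))
  rw [norm_inv, Real.norm_eq_abs]
  exact inv_anti₀ hδ (le_abs_sub_of_ball_subset_compl hball ht)

theorem continuousAt_logSzego {a b x : ℝ} (hab : a ≤ b) (hx : x ∉ Icc a b) {L : ℝ → ℝ}
    (hL : Integrable L (eta a b)) : ContinuousAt (logSzego a b L) x := by
  obtain ⟨δ, hδ, hball⟩ := Metric.isOpen_iff.1 isClosed_Icc.isOpen_compl x hx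
  have hnear : ∀ᶠ u in 𝓝 x, ∀ t ∈ Icc a b, δ / 2 ≤ |t - u| := by
    filter_upwards [Metric.ball_mem_nhds x (half_pos hδ)] with u hu t ht
    refine le_abs_sub_of_ball_subset_compl (fun v hv => hball ?_) ht
    rw [Metric.mem_ball] at hu hv ⊢
    linarith [dist_triangle v u x]
  have hint : ContinuousAt (fun u => ∫ t, L t / (t - u) ∂(eta a b)) x := by
    refine continuousAt_of_dominated (bound := fun t => |L t| * (δ / 2)⁻¹) ?_ ?_
      (hL.abs.mul_const _) ?_
    · refine Eventually.of_forall fun u => ?_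
      simp only [div_eq_mul_inv]
      exact hL.aestronglyMeasurable.mul (by fun_prop)
    · filter_upwards [hnear] with u hu
      refine ae_eta_iff.2 (Eventually.of_forall fun t ht => ?_)
      rw [norm_div, Real.norm_eq_abs, Real.norm_eq_abs, div_eq_mul_inv]
      exact mul_le_mul_of_nonneg_left (inv_anti₀ (half_pos hδ) (hu t ht)) (abs_nonneg _)
    · refine ae_eta_iff.2 (Eventually.of_forall fun t ht => ?_)
      refine ContinuousAt.div (by fun_prop) (by fun_prop) fun h => ?_
      rw [sub_eq_zero] at h
      exact hx (h ▸ ht)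
  have h0 : x - a ≠ 0 := fun h => hx (by rw [sub_eq_zero.1 h]; exact left_mem_Icc.2 hab)
  unfold logSzego
  refine ContinuousAt.mul ?_ hint
  refine (ContinuousAt.mul (by fun_prop) (ContinuousAt.sqrt ?_)).div_const _
  exact ContinuousAt.div (by fun_prop) (by fun_prop) h0

/-- The map from `ln h` on `[a, b]` to `ln G` on the rest of the line is a contraction in the
supremum norms with constant `1/2`, because `√((x - a)(x - b)) ∫ dη(t) / |t - x| = π`. -/
theorem abs_logSzego_sub_le {a b x : ℝ} (hab : a < b) (hx : x ∉ Icc a b) {L₁ L₂ : ℝ → ℝ}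
    (h₁ : Integrable L₁ (eta a b)) (h₂ : Integrable L₂ (eta a b)) {C : ℝ}
    (hC : ∀ᵐ t ∂(eta a b), |L₁ t - L₂ t| ≤ C) :
    |logSzego a b L₁ x - logSzego a b L₂ x| ≤ 1 / 2 * C := by
  have hI : |∫ t, (L₁ t - L₂ t) / (t - x) ∂(eta a b)| ≤ C * ∫ t, 1 / |t - x| ∂(eta a b) := by
    rw [← integral_const_mul]
    refine abs_integral_le_integral_abs.trans (integral_mono_ae ?_ ?_ ?_)
    · exact (integrable_div_sub hx (h₁.sub h₂)).abs
    · exact (integrable_eta_inv_abs_sub hab hx).const_mul C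
    · filter_upwards [hC] with t ht
      change |(L₁ t - L₂ t) / (t - x)| ≤ C * (1 / |t - x|)
      rw [abs_div, mul_one_div]
      gcongr
  have hsub : logSzego a b L₁ x - logSzego a b L₂ x
      = (x - a) * Real.sqrt ((x - b) / (x - a)) / (2 * Real.pi) *
        ∫ t, (L₁ t - L₂ t) / (t - x) ∂(eta a b) := by
    simp only [logSzego, sub_div]
    rw [integral_sub (integrable_div_sub hx h₁) (integrable_div_sub hx h₂), mul_sub]
  have hpi := Real.pi_pos
  rw [hsub, abs_mul, abs_div, abs_sub_mul_sqrt_div hab.le hx, abs_of_pos (by positivity)]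
  refine (mul_le_mul_of_nonneg_left hI (by positivity)).trans_eq ?_
  have := integral_eta_inv_abs_sub hab hx
  calc _ = C / (2 * Real.pi) *
        (Real.sqrt ((x - a) * (x - b)) * ∫ t, 1 / |t - x| ∂(eta a b)) := by ring
    _ = _ := by rw [this]; field_simp

/-! ### The operator -/

variable {m : ℕ} {a b : Fin m → ℝ}

theorem notMem_Icc_of_mem_nbrSet
    (hdisj : ∀ i j : Fin m, (i : ℕ) + 1 = j → Disjoint (Icc (a i) (b i)) (Icc (a j) (b j)))
    {j : Fin m} {x : ℝ} (hx : x ∈ nbrSet a b j) : x ∉ Icc (a j) (b j) := by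
  obtain ⟨⟨i, hi⟩, hxi⟩ := mem_iUnion.1 hx
  rcases hi with hi | hi
  · exact disjoint_left.1 (hdisj i j hi) hxi
  · exact disjoint_right.1 (hdisj j i hi) hxi

/-- `ln (f_{j-1} f_{j+1})` on `Δ_j`, continued to the line by constants. -/
def nbrLogSum (hab : ∀ j, a j < b j) (f : PosVec a b) (j : Fin m) (t : ℝ) : ℝ :=
  ∑ i : {i : Fin m // Adj i j}, f.log i
    ⟨projIcc (a j) (b j) (hab j).le t, mem_nbrSet i.2 (projIcc (a j) (b j) (hab j).le t).2⟩

theorem continuous_nbrLogSum (hab : ∀ j, a j < b j) (f : PosVec a b) (j : Fin m) :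
    Continuous (nbrLogSum hab f j) := by
  refine continuous_finsetSum _ fun i _ => (f.log i).continuous.comp ?_
  exact (continuous_subtype_val.comp continuous_projIcc).subtype_mk _

theorem exp_nbrLogSum (hab : ∀ j, a j < b j) (f : PosVec a b) {j : Fin m} {x : ℝ}
    (hx : x ∈ Icc (a j) (b j)) : Real.exp (nbrLogSum hab f j x) = nbrProd f j x hx := by
  rw [nbrLogSum, Real.exp_sum, nbrProd]
  refine Finset.prod_congr rfl fun i _ => ?_
  simp only [projIcc_of_mem (hab j).le hx]
  exact Real.exp_log (f.pos _ _)

theorem abs_nbrLogSum_sub_le (hab : ∀ j, a j < b j) (f g : PosVec a b) (j : Fin m) (t : ℝ) :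
    |nbrLogSum hab f j t - nbrLogSum hab g j t|
      ≤ ∑ i : {i : Fin m // Adj i j}, dist (f.log i) (g.log i) := by
  rw [nbrLogSum, nbrLogSum, ← Finset.sum_sub_distrib]
  refine (Finset.abs_sum_le_sum_abs _ _).trans (Finset.sum_le_sum fun i _ => ?_)
  rw [← Real.dist_eq]
  exact ContinuousMap.dist_apply_le_dist _

theorem integrable_nbrLogSum (hab : ∀ j, a j < b j) (f : PosVec a b) (j : Fin m) :
    Integrable (nbrLogSum hab f j) (eta (a j) (b j)) := by
  have := isFiniteMeasure_eta (hab j)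
  refine Integrable.of_bound (continuous_nbrLogSum hab f j).aestronglyMeasurable
    (∑ i : {i : Fin m // Adj i j}, ‖f.log i‖) (Eventually.of_forall fun t => ?_)
  exact (norm_sum_le _ _).trans (Finset.sum_le_sum fun i _ => (f.log i).norm_coe_le_norm _)

/-- The weight `w_j / (f_{j-1} f_{j+1})` whose Szegő function is `T_j f`. -/
def imageWeight (hab : ∀ j, a j < b j) (w : Fin m → ℝ → ℝ) (f : PosVec a b) (j : Fin m)
    (t : ℝ) : ℝ :=
  w j t * Real.exp (-nbrLogSum hab f j t)

theorem inv_imageWeight (hab : ∀ j, a j < b j) (w : Fin m → ℝ → ℝ) (f : PosVec a b) {j : Fin m}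
    {x : ℝ} (hx : x ∈ Icc (a j) (b j)) :
    (imageWeight hab w f j x)⁻¹ = nbrProd f j x hx / w j x := by
  rw [imageWeight, ← exp_nbrLogSum hab f hx, Real.exp_neg, mul_inv, inv_inv]
  ring

theorem log_imageWeight_ae (hab : ∀ j, a j < b j) {w : Fin m → ℝ → ℝ}
    (hw : ∀ j, LogIntegrable (a j) (b j) (w j)) (f : PosVec a b) (j : Fin m) :
    (fun t => Real.log (w j t) - nbrLogSum hab f j t) =ᵐ[eta (a j) (b j)]
      fun t => Real.log (imageWeight hab w f j t) := by
  filter_upwards [(hw j).1] with t ht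
  rw [imageWeight, Real.log_mul ht.ne' (Real.exp_pos _).ne', Real.log_exp, sub_eq_add_neg]

theorem logIntegrable_imageWeight (hab : ∀ j, a j < b j) {w : Fin m → ℝ → ℝ}
    (hw : ∀ j, LogIntegrable (a j) (b j) (w j)) (f : PosVec a b) (j : Fin m) :
    LogIntegrable (a j) (b j) (imageWeight hab w f j) :=
  ⟨(hw j).1.mono fun _ ht => mul_pos ht (Real.exp_pos _),
    ((hw j).2.sub (integrable_nbrLogSum hab f j)).congr (log_imageWeight_ae hab hw f j)⟩

/-- The operator `T_w`: its `j`-th component is the Szegő function of `w_j / (f_{j-1} f_{j+1})`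
on `Δ_{j-1} ∪ Δ_{j+1}`. -/
def szegoOp (hab : ∀ j, a j < b j)
    (hdisj : ∀ i j : Fin m, (i : ℕ) + 1 = j → Disjoint (Icc (a i) (b i)) (Icc (a j) (b j)))
    {w : Fin m → ℝ → ℝ} (hw : ∀ j, LogIntegrable (a j) (b j) (w j)) (f : PosVec a b) :
    PosVec a b where
  toFun j :=
    ⟨fun x => Real.exp (logSzego (a j) (b j)
        (fun t => Real.log (imageWeight hab w f j t)) x),
      Real.continuous_exp.comp (continuous_iff_continuousAt.2 fun x =>
        (continuousAt_logSzego (hab j).le (notMem_Icc_of_mem_nbrSet hdisj x.2)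
          (logIntegrable_imageWeight hab hw f j).2).comp continuousAt_subtype_val)⟩
  pos _ _ := Real.exp_pos _

section

variable (hab : ∀ j, a j < b j)
  (hdisj : ∀ i j : Fin m, (i : ℕ) + 1 = j → Disjoint (Icc (a i) (b i)) (Icc (a j) (b j)))
  {w : Fin m → ℝ → ℝ} (hw : ∀ j, LogIntegrable (a j) (b j) (w j))

theorem szegoOp_toFun (f : PosVec a b) (j : Fin m) (x : nbrSet a b j) :
    (((szegoOp hab hdisj hw f).toFun j x : ℝ) : ℂ)
      = szegoFun (a j) (b j) (imageWeight hab w f j) ((x : ℝ) : ℂ) :=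
  (szegoFun_ofReal (hab j).le (notMem_Icc_of_mem_nbrSet hdisj x.2) _).symm

theorem isImage_szegoOp (f : PosVec a b) : IsImage w f (szegoOp hab hdisj hw f) := by
  intro j
  have hh := logIntegrable_imageWeight hab hw f j
  refine ⟨szegoFun (a j) (b j) (imageWeight hab w f j), ⟨_, hh, fun _ _ => rfl⟩, ?_,
    fun x => (szegoOp_toFun hab hdisj hw f j x).symm⟩
  filter_upwards [ae_tendsto_norm_sq_szegoFun (hab j) hh] with x hx hxI
  rw [← inv_imageWeight hab w f hxI]
  exact hx hxI

/-- A Szegő function is determined by the moduli of its boundary values, since they determine the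
weight almost everywhere. -/
theorem IsImage.eq_szegoOp {f g : PosVec a b} (h : IsImage w f g) :
    szegoOp hab hdisj hw f = g := by
  ext j x
  obtain ⟨G, ⟨h', hh', hG⟩, hbd, hval⟩ := h j
  have hh := logIntegrable_imageWeight hab hw f j
  have hlog : (fun t => Real.log (h' t)) =ᵐ[eta (a j) (b j)]
      fun t => Real.log (imageWeight hab w f j t) := by
    refine ae_eta_iff.2 ?_
    filter_upwards [ae_tendsto_norm_sq_szegoFun (hab j) hh', hbd] with t h1 h2 ht
    have h3 : Tendsto (fun y : ℝ => ‖szegoFun (a j) (b j) h' ((t : ℂ) + (y : ℂ) * Complex.I)‖ ^ 2)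
        (𝓝[≠] 0) (𝓝 (nbrProd f j t ht / w j t)) := by
      refine (h2 ht).congr' ?_
      filter_upwards [self_mem_nhdsWithin] with y hy
      rw [hG]
      rintro ⟨s, -, hs⟩
      have := congrArg Complex.im hs
      simp at this
      exact hy this.symm
    have h4 := tendsto_nhds_unique (h1 ht) h3
    rw [← inv_imageWeight hab w f ht] at h4
    rw [inv_injective h4]
  have hx := notMem_Icc_of_mem_nbrSet hdisj x.2
  have hxi : ((x : ℝ) : ℂ) ∉ ((↑) : ℝ → ℂ) '' Icc (a j) (b j) := by
    rintro ⟨s, hs, hsx⟩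
    exact hx (Complex.ofReal_injective hsx ▸ hs)
  have hint : ∫ t, ((Real.log (h' t) : ℝ) : ℂ) / ((t : ℂ) - (x : ℝ)) ∂(eta (a j) (b j))
      = ∫ t, ((Real.log (imageWeight hab w f j t) : ℝ) : ℂ) / ((t : ℂ) - (x : ℝ))
          ∂(eta (a j) (b j)) := by
    refine integral_congr_ae ?_
    filter_upwards [hlog] with t ht
    rw [ht]
  apply Complex.ofReal_injective
  rw [szegoOp_toFun, ← hval x, hG _ hxi, szegoFun, szegoFun, hint]

theorem dist_log_szegoOp_le (f g : PosVec a b) (j : Fin m) :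
    dist ((szegoOp hab hdisj hw f).log j) ((szegoOp hab hdisj hw g).log j)
      ≤ 1 / 2 * ∑ i : {i : Fin m // Adj i j}, dist (f.log i) (g.log i) := by
  refine (ContinuousMap.dist_le (mul_nonneg (by norm_num)
    (Finset.sum_nonneg fun i _ => dist_nonneg))).2 fun x => ?_
  have hlog : ∀ f : PosVec a b, (szegoOp hab hdisj hw f).log j x
      = logSzego (a j) (b j) (fun t => Real.log (imageWeight hab w f j t)) x :=
    fun f => Real.log_exp _
  rw [hlog, hlog, Real.dist_eq]
  refine abs_logSzego_sub_le (hab j) (notMem_Icc_of_mem_nbrSet hdisj x.2)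
    (logIntegrable_imageWeight hab hw f j).2 (logIntegrable_imageWeight hab hw g j).2 ?_
  filter_upwards [log_imageWeight_ae hab hw f j, log_imageWeight_ae hab hw g j] with t hf hg
  rw [← hf, ← hg, sub_sub_sub_cancel_left, abs_sub_comm]
  exact abs_nbrLogSum_sub_le hab f g j t

end

end

variable {m : ℕ} {a b : Fin m → ℝ}

/-! ### Completeness -/

theorem isometry_log : Isometry (PosVec.log (a := a) (b := b)) :=
  Isometry.of_dist_eq fun f g => (logSupDist_eq f g).symm

theorem surjective_log : Function.Surjective (PosVec.log (a := a) (b := b)) := fun u =>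
  ⟨⟨fun j => ⟨fun x => Real.exp (u j x), by fun_prop⟩, fun _ _ => Real.exp_pos _⟩, by
    ext j x
    exact Real.log_exp _⟩

theorem completeSpace_posVec : CompleteSpace (PosVec a b) := by
  rw [completeSpace_iff_isComplete_range isometry_log.isUniformInducing,
    surjective_log.range_eq]
  exact completeSpace_iff_isComplete_univ.1 inferInstance

/-! ### Survival of the simple random walk on a path -/

/-- A lower bound for the probability that a simple random walk at distance `n` from an exit has
left through it within `k` steps: that of the straight walk to the exit. -/
noncomputable def exitBound (k n : ℕ) : ℝ := if n ≤ k then (1 / 2) ^ n else 0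

theorem exitBound_nonneg (k n : ℕ) : 0 ≤ exitBound k n := by
  unfold exitBound
  split_ifs <;> positivity

theorem exitBound_zero_right (k : ℕ) : exitBound k 0 = 1 := by simp [exitBound]

theorem exitBound_succ_succ (k n : ℕ) : exitBound (k + 1) (n + 1) = 1 / 2 * exitBound k n := by
  simp [exitBound, pow_succ']

theorem half_pow_le_exitBound {k n l : ℕ} (h : n ≤ l) (hl : l ≤ k) :
    (1 / 2 : ℝ) ^ l ≤ exitBound k n := by
  rw [exitBound, if_pos (h.trans hl)]
  exact pow_le_pow_of_le_one (by norm_num) (by norm_num) h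

theorem sum_adj_eq (u : ℕ → ℝ) (j : Fin m) :
    ∑ i : {i : Fin m // Adj i j}, u (i : Fin m)
      = (if 0 < (j : ℕ) then u (j - 1) else 0) + if (j : ℕ) + 1 < m then u (j + 1) else 0 := by
  have h1 : ∑ i : {i : Fin m // Adj i j}, u (i : Fin m)
      = ∑ i : Fin m, if Adj i j then u i else 0 := by
    rw [← Finset.sum_filter]
    exact (Finset.sum_subtype _ (by simp) fun i : Fin m => u i).symm
  have h2 : ∀ i : Fin m, (if Adj i j then u i else 0)
      = (if (i : ℕ) + 1 = j then u i else 0) + if (j : ℕ) + 1 = i then u i else 0 := by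
    intro i
    by_cases h : (i : ℕ) + 1 = j
    · have h' : (j : ℕ) + 1 ≠ i := by omega
      simp [Adj, h, h']
    · simp [Adj, h]
  rw [h1, Finset.sum_congr rfl fun i _ => h2 i, Finset.sum_add_distrib]
  have := j.2
  congr 1
  · split_ifs with h
    · rw [Finset.sum_eq_single (⟨j - 1, by omega⟩ : Fin m)]
      · exact if_pos (by simp; omega)
      · intro i _ hi
        exact if_neg fun h' => hi (Fin.ext (by simp; omega))
      · simp
    · exact Finset.sum_eq_zero fun i _ => if_neg (by omega)
  · split_ifs with h
    · rw [Finset.sum_eq_single (⟨j + 1, h⟩ : Fin m)]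
      · simp
      · intro i _ hi
        exact if_neg fun h' => hi (Fin.ext (by simp; omega))
      · simp
    · exact Finset.sum_eq_zero fun i _ => if_neg (by omega)

/-- One step of the walk on `{0, …, m - 1}` with exits at `-1` and `m`. -/
theorem half_sum_adj_le (k : ℕ) (j : Fin m) :
    1 / 2 * ∑ i : {i : Fin m // Adj i j},
        (1 - exitBound k ((i : Fin m) + 1) - exitBound k (m - (i : Fin m)))
      ≤ 1 - exitBound (k + 1) (j + 1) - exitBound (k + 1) (m - j) := by
  have hj := j.2
  rw [sum_adj_eq (fun i => 1 - exitBound k (i + 1) - exitBound k (m - i))]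
  obtain ⟨n, hn⟩ : ∃ n, m - (j : ℕ) = n + 1 := ⟨m - j - 1, by omega⟩
  rw [hn, exitBound_succ_succ, exitBound_succ_succ]
  -- an exit behaves like a site with `exitBound k 0 = 1`
  have hl : (if 0 < (j : ℕ) then 1 - exitBound k ((j : ℕ) - 1 + 1) - exitBound k (m - (j - 1))
      else 0) ≤ 1 - exitBound k j := by
    split_ifs with h
    · rw [Nat.sub_add_cancel h]
      linarith [exitBound_nonneg k (m - (j - 1))]
    · rw [show (j : ℕ) = 0 by omega, exitBound_zero_right, sub_self]
  have hr : (if (j : ℕ) + 1 < m then 1 - exitBound k ((j : ℕ) + 1 + 1) - exitBound k (m - (j + 1))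
      else 0) ≤ 1 - exitBound k n := by
    split_ifs with h
    · rw [show m - ((j : ℕ) + 1) = n by omega]
      linarith [exitBound_nonneg k ((j : ℕ) + 1 + 1)]
    · rw [show n = 0 by omega, exitBound_zero_right, sub_self]
  linarith

theorem contractionConst_lt_one (m : ℕ) : contractionConst m < 1 := by
  unfold contractionConst
  split_ifs <;> rw [div_lt_one (by positivity)] <;> linarith

theorem contractionConst_eq (m : ℕ) : contractionConst m
    = if Even m then 1 - (1 / 2) ^ ceilHalf m else 1 - 2 * (1 / 2) ^ ceilHalf m := by
  unfold contractionConst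
  split_ifs <;> rw [one_div, inv_pow] <;> field_simp

/-- In `⌈m/2⌉` steps every site can reach an exit; if `m` is odd, the middle site can reach both,
and the other sites have a step to spare. -/
theorem one_sub_exitBound_le (j : Fin m) :
    1 - exitBound (ceilHalf m) (j + 1) - exitBound (ceilHalf m) (m - j) ≤ contractionConst m := by
  have hj := j.2
  rw [contractionConst_eq]
  have h1 := exitBound_nonneg (ceilHalf m) (j + 1)
  have h2 := exitBound_nonneg (ceilHalf m) (m - j)
  obtain ⟨k, hk⟩ : ∃ k, ceilHalf m = k := ⟨_, rfl⟩
  rw [hk] at h1 h2 ⊢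
  unfold ceilHalf at hk
  split_ifs with hm
  · obtain ⟨l, hl⟩ := hm
    rcases le_or_gt ((j : ℕ) + 1) k with h | h
    · linarith [half_pow_le_exitBound h le_rfl]
    · linarith [half_pow_le_exitBound (show m - (j : ℕ) ≤ k by omega) le_rfl]
  · obtain ⟨l, hl⟩ := Nat.not_even_iff_odd.1 hm
    obtain rfl : k = l + 1 := by omega
    rcases lt_trichotomy ((j : ℕ) + 1) (l + 1) with h | h | h
    · linarith [half_pow_le_exitBound (Nat.le_of_lt_succ h) (Nat.le_succ l),
        pow_succ (1 / 2 : ℝ) l]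
    · linarith [half_pow_le_exitBound h.le le_rfl,
        half_pow_le_exitBound (show m - (j : ℕ) ≤ l + 1 by omega) le_rfl]
    · linarith [half_pow_le_exitBound (show m - (j : ℕ) ≤ l by omega) (Nat.le_succ l),
        pow_succ (1 / 2 : ℝ) l]

/-! ### Contraction of the iterate -/

/-- A map whose components contract by the transition matrix of the walk contracts, after `k`
steps, by the survival probabilities. -/
theorem dist_log_iterate_le {T : PosVec a b → PosVec a b}
    (hT : ∀ f g j, dist ((T f).log j) ((T g).log j)
      ≤ 1 / 2 * ∑ i : {i : Fin m // Adj i j}, dist (f.log i) (g.log i))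
    (f g : PosVec a b) (k : ℕ) (j : Fin m) :
    dist ((T^[k] f).log j) ((T^[k] g).log j)
      ≤ (1 - exitBound k (j + 1) - exitBound k (m - j)) * dist f g := by
  induction k generalizing j with
  | zero =>
    have h : m - (j : ℕ) ≠ 0 := by omega
    simp only [exitBound, Function.iterate_zero, id]
    simp only [Nat.le_zero, h, Nat.add_eq_zero_iff, one_ne_zero, and_false, if_false, sub_zero,
      one_mul]
    exact (dist_le_pi_dist _ _ j).trans_eq (isometry_log.dist_eq f g)
  | succ k ih =>
    rw [Function.iterate_succ_apply', Function.iterate_succ_apply']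
    refine (hT _ _ j).trans ?_
    refine le_trans ?_ (mul_le_mul_of_nonneg_right (half_sum_adj_le k j) dist_nonneg)
    rw [mul_assoc, Finset.sum_mul]
    exact mul_le_mul_of_nonneg_left (Finset.sum_le_sum fun i _ => ih i) (by norm_num)

theorem dist_iterate_ceilHalf_le {T : PosVec a b → PosVec a b}
    (hT : ∀ f g j, dist ((T f).log j) ((T g).log j)
      ≤ 1 / 2 * ∑ i : {i : Fin m // Adj i j}, dist (f.log i) (g.log i))
    (hm : 0 ≤ contractionConst m) (f g : PosVec a b) :
    dist (T^[ceilHalf m] f) (T^[ceilHalf m] g) ≤ contractionConst m * dist f g := by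
  rw [← isometry_log.dist_eq, dist_pi_le_iff (mul_nonneg hm dist_nonneg)]
  exact fun j => (dist_log_iterate_le hT f g _ j).trans
    (mul_le_mul_of_nonneg_right (one_sub_exitBound_le j) dist_nonneg)

theorem contractionConst_nonneg (hm : 2 ≤ m) : 0 ≤ contractionConst m := by
  have h1 : 1 ≤ ceilHalf m := by unfold ceilHalf; omega
  have h : (2 : ℝ) ^ 1 ≤ 2 ^ ceilHalf m := pow_le_pow_right₀ (by norm_num) h1
  unfold contractionConst
  split_ifs <;> refine div_nonneg ?_ (by positivity) <;> linarith

end Szego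

/-- A map with a contracting iterate on a nonempty complete space has exactly one fixed point. -/
theorem existsUnique_fixedPoint_of_iterate {α : Type*} [MetricSpace α] [CompleteSpace α]
    [Nonempty α] {T : α → α} {n : ℕ} {K : ℝ} (h0 : 0 ≤ K) (h1 : K < 1)
    (hT : ∀ x y, dist (T^[n] x) (T^[n] y) ≤ K * dist x y) : ∃! x, T x = x := by
  have hc : ContractingWith ⟨K, h0⟩ T^[n] :=
    ⟨h1, LipschitzWith.of_dist_le_mul hT⟩
  refine ⟨_, hc.isFixedPt_fixedPoint_iterate, fun y hy => ?_⟩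
  exact hc.fixedPoint_unique (Function.IsFixedPt.iterate hy n)

theorem theorem1p6 (m : ℕ) (hm : 2 ≤ m) (a b : Fin m → ℝ)
    (hab : ∀ j, a j < b j)
    (hdisj : ∀ i j : Fin m, (i : ℕ) + 1 = j → Disjoint (Set.Icc (a i) (b i)) (Set.Icc (a j) (b j)))
    (w : Fin m → ℝ → ℝ)
    (hw : ∀ j, Szego.LogIntegrable (a j) (b j) (w j)) :
    CompleteSpace (Szego.PosVec a b) ∧
    ∃ T : Szego.PosVec a b → Szego.PosVec a b,
      (∀ f g, T f = g ↔ Szego.IsImage w f g) ∧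
      Szego.contractionConst m < 1 ∧
      (∀ f g, dist (T^[Szego.ceilHalf m] f) (T^[Szego.ceilHalf m] g)
        ≤ Szego.contractionConst m * dist f g) ∧
      ∃! f, T f = f := by
  have hcomplete := Szego.completeSpace_posVec (a := a) (b := b)
  have : Nonempty (Szego.PosVec a b) := ⟨⟨fun _ => 1, fun _ _ => one_pos⟩⟩
  have hcontr := Szego.dist_iterate_ceilHalf_le (Szego.dist_log_szegoOp_le hab hdisj hw)
    (Szego.contractionConst_nonneg hm)
  refine ⟨hcomplete, Szego.szegoOp hab hdisj hw, fun f g => ⟨?_, ?_⟩,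
    Szego.contractionConst_lt_one m, hcontr, ?_⟩
  · rintro rfl
    exact Szego.isImage_szegoOp hab hdisj hw f
  · exact Szego.IsImage.eq_szegoOp hab hdisj hw
  · exact existsUnique_fixedPoint_of_iterate (Szego.contractionConst_nonneg hm)
      (Szego.contractionConst_lt_one m) hcontr
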